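/- Let $N\ge 1$ and $\kappa>0$. For $\nu>0$ and $a:\mathbb{R}^N\to\mathbb{R}$ we say that $a$ satisfies $(H_1)$ with constants $\kappa,\nu$ if $a\in C^4(\mathbb{R}^N)$, $a(x)\ge \nu$, and for all $x\in\mathbb{R}^N$ and all $i,j,k,l\in\{1,\dots,N\}$ $$|D_{ijkl}a(x)|\le \kappa^4 a(x)^{-1},\quad |D_{ijk}a(x)|\le \kappa^3 a(x)^{-1/2},\quad |D_{ij}a(x)|\le\kappa^2,\quad |D_i a(x)|\le \kappa\, a(x)^{1/2}.$$ Let $A=-a(x)^2\Delta^2$, acting on complex-valued functions, let $$D(A_1)=\{u\in L^1(\mathbb{R}^N):\ a^{1/2}Du,\ aD^2u,\ a^{3/2}D^3u,\ a^2\Delta^2u\in L^1(\mathbb{R}^N)\}$$ with derivatives in the distributional sense, let $\|\cdot\|_1$ be the norm of $L^1(\mathbb{R}^N)$, and let $|D^hu|=\big(\sum_{i_1,\dots,i_h=1}^N|D_{i_1\dots i_h}u|^2\big)^{1/2}$. (i) There exist constants $C>0$ and $\varepsilon_0>0$, depending only on $N$ and $\kappa$, such that for every $\nu>0$, every $a$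 satisfying $(H_1)$ with constants $\kappa,\nu$, every $0<\varepsilon<\varepsilon_0$, every $u\in C_c^\infty(\mathbb{R}^N)$ and $h=1,2,3$, $$\|a^{h/2}D^hu\|_1\le \varepsilon^{4-h}\|Au\|_1+\frac{C}{\varepsilon^h}\|u\|_1 .$$ (ii) There exists a constant $C>0$, depending only on $N$ and $\kappa$, such that for every $\nu>0$, every $a$ satisfying $(H_1)$ with constants $\kappa,\nu$, and every $u\in D(A_1)$, $$\|a^{1/2}Du\|_1+\|aD^2u\|_1+\|a^{3/2}D^3u\|_1\le C\left(\|Au\|_1+\|u\|_1\right).$$ -/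

import Mathlib

open MeasureTheory
open scoped ENNReal ContDiff InnerProductSpace

noncomputable section

namespace FourthOrderL1

/-- The Euclidean space `ℝ^N`. -/
abbrev Eucl (N : ℕ) : Type := EuclideanSpace ℝ (Fin N)

/-- The classical partial derivative `D_{i₁ … i_h} f (x)` along the coordinate directions listed by
the multi-index `I = (i₁, …, i_h)`. -/
def partialDeriv {N h : ℕ} {F : Type*} [NormedAddCommGroup F] [NormedSpace ℝ F]
    (I : Fin h → Fin N) (f : Eucl N → F) (x : Eucl N) : F :=
  iteratedFDeriv ℝ h f x (fun j => EuclideanSpace.single (I j) (1 : ℝ))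

/-- The standing assumptions on the coefficient `a` (with constants `κ`, `ν`):
`a ∈ C⁴(ℝ^N)`, `a ≥ ν > 0`, and the growth bounds on the derivatives of `a` up to order four. -/
structure CoeffAssumption (N : ℕ) (κ ν : ℝ) (a : Eucl N → ℝ) : Prop where
  kappa_pos : 0 < κ
  nu_pos : 0 < ν
  contDiff : ContDiff ℝ 4 a
  lower_bound : ∀ x, ν ≤ a x
  bound_four : ∀ (I : Fin 4 → Fin N) (x : Eucl N), |partialDeriv I a x| ≤ κ ^ 4 * (a x)⁻¹
  bound_three : ∀ (I : Fin 3 → Fin N) (x : Eucl N),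
    |partialDeriv I a x| ≤ κ ^ 3 * (a x) ^ (-(1 / 2) : ℝ)
  bound_two : ∀ (I : Fin 2 → Fin N) (x : Eucl N), |partialDeriv I a x| ≤ κ ^ 2
  bound_one : ∀ (I : Fin 1 → Fin N) (x : Eucl N),
    |partialDeriv I a x| ≤ κ * (a x) ^ (1 / 2 : ℝ)

/-- `f ∈ C_c^∞(ℝ^N)`. -/
def IsTestFunction {N : ℕ} {F : Type*} [NormedAddCommGroup F] [NormedSpace ℝ F]
    (f : Eucl N → F) : Prop :=
  ContDiff ℝ ∞ f ∧ HasCompactSupport f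

/-- `v` is a weak (distributional) derivative `D_{i₁ … i_h} u`, represented by a locally
integrable function. -/
def HasWeakDeriv {N h : ℕ} (I : Fin h → Fin N) (u v : Eucl N → ℂ) : Prop :=
  LocallyIntegrable v volume ∧
    ∀ φ : Eucl N → ℝ, IsTestFunction φ →
      ∫ x, partialDeriv I φ x • u x = (-1 : ℝ) ^ h • ∫ x, φ x • v x

/-- `w` represents the distribution `Δ² u` (the pure fourth order derivatives of `u` need not
be functions). -/
def HasWeakBilaplacian {N : ℕ} (u w : Eucl N → ℂ) : Prop :=
  LocallyIntegrable w volume ∧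
    ∀ φ : Eucl N → ℝ, IsTestFunction φ →
      ∫ x, Laplacian.laplacian (Laplacian.laplacian φ) x • u x = ∫ x, φ x • w x

/-- Weak derivatives are unique up to null sets. -/
theorem HasWeakDeriv.ae_eq {N h : ℕ} {I : Fin h → Fin N} {u v v' : Eucl N → ℂ}
    (hv : HasWeakDeriv I u v) (hv' : HasWeakDeriv I u v') : v =ᵐ[volume] v' := by
  refine ae_eq_of_integral_contDiff_smul_eq hv.1 hv'.1 fun g hg hg' => ?_
  have e := (hv.2 g ⟨hg, hg'⟩).symm.trans (hv'.2 g ⟨hg, hg'⟩)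
  exact smul_right_injective ℂ (pow_ne_zero h (by norm_num : (-1 : ℝ) ≠ 0)) e

/-- The weak bilaplacian is unique up to null sets. -/
theorem HasWeakBilaplacian.ae_eq {N : ℕ} {u w w' : Eucl N → ℂ}
    (hw : HasWeakBilaplacian u w) (hw' : HasWeakBilaplacian u w') : w =ᵐ[volume] w' :=
  ae_eq_of_integral_contDiff_smul_eq hw.1 hw'.1 fun g hg hg' =>
    (hw.2 g ⟨hg, hg'⟩).symm.trans (hw'.2 g ⟨hg, hg'⟩)

open Classical in
/-- A representative of the weak derivative `D_{i₁ … i_h} u` (`0` if there is none; on the domain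
below there is one). -/
def weakDeriv {N h : ℕ} (I : Fin h → Fin N) (u : Eucl N → ℂ) : Eucl N → ℂ :=
  if H : ∃ v, HasWeakDeriv I u v then H.choose else 0

open Classical in
/-- A representative of `Δ² u` (`0` if there is none; on the domain below there is one). -/
def weakBilaplacian {N : ℕ} (u : Eucl N → ℂ) : Eucl N → ℂ :=
  if H : ∃ w, HasWeakBilaplacian u w then H.choose else 0

theorem weakDeriv_spec {N h : ℕ} {I : Fin h → Fin N} {u : Eucl N → ℂ}
    (H : ∃ v, HasWeakDeriv I u v) : HasWeakDeriv I u (weakDeriv I u) := by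
  rw [weakDeriv, dif_pos H]
  exact H.choose_spec

theorem weakBilaplacian_spec {N : ℕ} {u : Eucl N → ℂ}
    (H : ∃ w, HasWeakBilaplacian u w) : HasWeakBilaplacian u (weakBilaplacian u) := by
  rw [weakBilaplacian, dif_pos H]
  exact H.choose_spec

/-- The domain `D(A_1) = {u ∈ L¹ : a^{1/2} D u, a D² u, a^{3/2} D³ u, a² Δ² u ∈ L¹}`, all
derivatives being understood in the weak sense. -/
def domA1 {N : ℕ} (a : Eucl N → ℝ) : Set (Eucl N → ℂ) :=
  {u | MemLp u 1 volume ∧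
    (∀ h : ℕ, 1 ≤ h → h ≤ 3 → ∀ I : Fin h → Fin N,
      (∃ v, HasWeakDeriv I u v) ∧
        MemLp (fun x => (a x) ^ ((h : ℝ) / 2) • weakDeriv I u x) 1 volume) ∧
    (∃ w, HasWeakBilaplacian u w) ∧
      MemLp (fun x => (a x) ^ 2 • weakBilaplacian u x) 1 volume}

/-- The operator `A = -a² Δ²` on its domain (weak form). -/
def opA {N : ℕ} (a : Eucl N → ℝ) (u : Eucl N → ℂ) : Eucl N → ℂ :=
  fun x => -((a x) ^ 2 • weakBilaplacian u x)

/-- The operator `A = -a² Δ²` on smooth functions (classical form). -/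
def opAClassical {N : ℕ} (a : Eucl N → ℝ) (u : Eucl N → ℂ) : Eucl N → ℂ :=
  fun x => -((a x) ^ 2 • Laplacian.laplacian (Laplacian.laplacian u) x)

/-- The `L¹(ℝ^N)` norm. -/
def normL1 {N : ℕ} {F : Type*} [NormedAddCommGroup F] (f : Eucl N → F) : ℝ≥0∞ :=
  eLpNorm f 1 volume

/-- `‖a^{h/2} D^h u‖₁`, where the family `V` consists of the partial derivatives of order `h`
of `u` and `|D^h u| = (∑_{i₁,…,i_h} |D_{i₁…i_h} u|²)^{1/2}`. -/
def weightedNorm {N h : ℕ} (a : Eucl N → ℝ) (V : (Fin h → Fin N) → Eucl N → ℂ) : ℝ≥0∞ :=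
  normL1 (fun x => (a x) ^ ((h : ℝ) / 2) * Real.sqrt (∑ I, ‖V I x‖ ^ 2))

end FourthOrderL1

end

open FourthOrderL1

/-! Both estimates come from one inequality for a triple `(u, v, w)` with `v = D_I u` and `w = Δ²u`
in the weak sense. No density argument enters, and no fourth order derivative other than `Δ²u`.

Let `g` be a smooth profile vanishing on `(1, ∞)`, `L f(t) = 4t f'' + 2N f'` the radial laplacian in
`t = |z|²`, and `p = (L g)'`. Then `∂ₛ [s⁻ᴺ p(|y-x|²/s²)] = -(s³⁻ᴺ/2) Δ² [g(|y-x|²/s²)]`. If `p` has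
positive mass, the means of `v` against this kernel, divided by the mass, tend to `v(x)` a.e. as `s
→ 0`. Hence `v(x)` is the mean at scale `r` minus the integral over `(0, r)` of the `s`-derivative
of the mean. In the mean, `D_I` passes to the kernel and costs `r⁻ʰ`. In the `s`-derivative, `Δ²`
passes to `u` and `D_I` to the kernel, which leaves `s³⁻ʰ` times an average of `|w|` over the ball
of radius `s`; this is integrable at `0` exactly because `h ≤ 3` (`exists_enorm_weakDeriv_le`).

The bound holds for all `r` off one null set, so `r = ε √a(x)` is allowed. Since `√a` is Lipschitz
with constant controlled by `N κ`, it varies by at most a factor 2 on such balls when `ε` is small.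
Multiplying by `a^{h/2}`, integrating in `x` and applying Tonelli reduces everything to integrals of
the kernels in `x` for fixed `y` (`exists_lintegral_weakDeriv_le`). -/

noncomputable section

namespace FourthOrderL1

/-! ### Coordinate derivatives, the laplacian and integration by parts -/

section Calculus

variable {N : ℕ} {F : Type*} [NormedAddCommGroup F] [NormedSpace ℝ F]

/-- The partial derivative in the `i`-th coordinate direction. -/
def coordDeriv (i : Fin N) (f : Eucl N → F) (x : Eucl N) : F :=
  fderiv ℝ f x (EuclideanSpace.single i (1 : ℝ))

theorem contDiff_coordDeriv {f : Eucl N → F} (hf : ContDiff ℝ ∞ f) (i : Fin N) :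
    ContDiff ℝ ∞ (coordDeriv i f) :=
  (hf.fderiv_right (m := ∞) (by simp)).clm_apply contDiff_const

theorem IsTestFunction.coordDeriv {f : Eucl N → F} (hf : IsTestFunction f) (i : Fin N) :
    IsTestFunction (coordDeriv i f) :=
  ⟨contDiff_coordDeriv hf.1 i, hf.2.fderiv_apply ℝ _⟩

theorem partialDeriv_zero (I : Fin 0 → Fin N) (f : Eucl N → F) : partialDeriv I f = f := by
  funext x
  simp [partialDeriv]

theorem partialDeriv_succ {h : ℕ} (I : Fin (h + 1) → Fin N) {f : Eucl N → F}
    (hf : ContDiff ℝ ∞ f) :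
    partialDeriv I f = coordDeriv (I 0) (partialDeriv (fun j => I j.succ) f) := by
  funext x
  have hd : DifferentiableAt ℝ (iteratedFDeriv ℝ h f) x :=
    (hf.differentiable_iteratedFDeriv (m := h) (by exact_mod_cast WithTop.coe_lt_top _)) x
  simp only [partialDeriv, coordDeriv, iteratedFDeriv_succ_apply_left]
  exact (fderiv_continuousMultilinear_apply_const_apply hd _ _).symm

theorem contDiff_partialDeriv {h : ℕ} (I : Fin h → Fin N) {f : Eucl N → F}
    (hf : ContDiff ℝ ∞ f) : ContDiff ℝ ∞ (partialDeriv I f) := by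
  induction h with
  | zero => rwa [partialDeriv_zero]
  | succ h ih =>
    rw [partialDeriv_succ I hf]
    exact contDiff_coordDeriv (ih _) _

theorem IsTestFunction.partialDeriv {h : ℕ} (I : Fin h → Fin N) {f : Eucl N → F}
    (hf : IsTestFunction f) : IsTestFunction (partialDeriv I f) := by
  induction h with
  | zero => rwa [partialDeriv_zero]
  | succ h ih =>
    rw [partialDeriv_succ I hf.1]
    exact (ih _).coordDeriv _

theorem coordDeriv_comm {f : Eucl N → F} (hf : ContDiff ℝ ∞ f) (i j : Fin N) :
    coordDeriv i (coordDeriv j f) = coordDeriv j (coordDeriv i f) := by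
  have key : ∀ (i j : Fin N) (x : Eucl N), coordDeriv i (coordDeriv j f) x =
      fderiv ℝ (fderiv ℝ f) x (EuclideanSpace.single i 1) (EuclideanSpace.single j 1) := by
    intro i j x
    have hd : DifferentiableAt ℝ (fderiv ℝ f) x :=
      (hf.fderiv_right (m := ∞) (by simp)).differentiable (by simp) x
    unfold coordDeriv
    rw [fderiv_clm_apply hd (differentiableAt_const _)]
    simp
  funext x
  rw [key, key]
  exact (hf.contDiffAt.isSymmSndFDerivAt
    (by simpa using (WithTop.coe_le_coe.2 le_top : ((2 : ℕ∞) : WithTop ℕ∞) ≤ ((⊤ : ℕ∞) : WithTop ℕ∞)))) _ _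

theorem coordDeriv_sum {ι : Type*} (s : Finset ι) (i : Fin N) {f : ι → Eucl N → F}
    (hf : ∀ k, ContDiff ℝ ∞ (f k)) :
    coordDeriv i (fun x => ∑ k ∈ s, f k x) = fun x => ∑ k ∈ s, coordDeriv i (f k) x := by
  funext x
  unfold coordDeriv
  rw [fderiv_fun_sum fun k _ => (hf k).differentiable (by simp) x]
  simp

theorem laplacian_eq_sum_coordDeriv {f : Eucl N → F} (hf : ContDiff ℝ ∞ f) :
    Laplacian.laplacian f = fun x => ∑ i, coordDeriv i (coordDeriv i f) x := by
  funext x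
  rw [InnerProductSpace.laplacian_eq_iteratedFDeriv_orthonormalBasis f
    (EuclideanSpace.basisFun (Fin N) ℝ)]
  refine Finset.sum_congr rfl fun i _ => ?_
  have hd : DifferentiableAt ℝ (fderiv ℝ f) x :=
    (hf.fderiv_right (m := ∞) (by simp)).differentiable (by simp) x
  unfold coordDeriv
  rw [fderiv_clm_apply hd (differentiableAt_const _), iteratedFDeriv_two_apply]
  simp

theorem contDiff_laplacian {f : Eucl N → F} (hf : ContDiff ℝ ∞ f) :
    ContDiff ℝ ∞ (Laplacian.laplacian f) := by
  rw [laplacian_eq_sum_coordDeriv hf]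
  exact ContDiff.sum fun i _ => contDiff_coordDeriv (contDiff_coordDeriv hf i) i

theorem IsTestFunction.laplacian {f : Eucl N → F} (hf : IsTestFunction f) :
    IsTestFunction (Laplacian.laplacian f) := by
  refine ⟨contDiff_laplacian hf.1, hf.2.mono' fun x hx => ?_⟩
  by_contra hxs
  refine hx ?_
  rw [laplacian_eq_sum_coordDeriv hf.1]
  refine Finset.sum_eq_zero fun i _ => ?_
  have h1 : x ∉ tsupport (FourthOrderL1.coordDeriv i (FourthOrderL1.coordDeriv i f)) := fun h =>
    hxs (tsupport_fderiv_apply_subset ℝ _ (tsupport_fderiv_apply_subset ℝ _ h))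
  exact image_eq_zero_of_notMem_tsupport h1

theorem coordDeriv_laplacian {f : Eucl N → F} (hf : ContDiff ℝ ∞ f) (i : Fin N) :
    coordDeriv i (Laplacian.laplacian f) = Laplacian.laplacian (coordDeriv i f) := by
  rw [laplacian_eq_sum_coordDeriv hf, laplacian_eq_sum_coordDeriv (contDiff_coordDeriv hf i),
    coordDeriv_sum _ _ fun k => contDiff_coordDeriv (contDiff_coordDeriv hf k) k]
  funext x
  refine Finset.sum_congr rfl fun k _ => ?_
  rw [coordDeriv_comm (contDiff_coordDeriv hf k), coordDeriv_comm hf]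

theorem partialDeriv_laplacian {h : ℕ} (I : Fin h → Fin N) {f : Eucl N → F}
    (hf : ContDiff ℝ ∞ f) :
    partialDeriv I (Laplacian.laplacian f) = Laplacian.laplacian (partialDeriv I f) := by
  induction h with
  | zero => rw [partialDeriv_zero, partialDeriv_zero]
  | succ h ih =>
    rw [partialDeriv_succ I hf, partialDeriv_succ I (contDiff_laplacian hf), ih,
      coordDeriv_laplacian (contDiff_partialDeriv _ hf)]

theorem integrable_smul_of_isTestFunction {φ : Eucl N → ℝ} (hφ : IsTestFunction φ)
    {u : Eucl N → F} (hu : Continuous u) : Integrable (fun x => φ x • u x) :=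
  (hφ.1.continuous.smul hu).integrable_of_hasCompactSupport hφ.2.smul_right

theorem integral_coordDeriv_smul {φ : Eucl N → ℝ} (hφ : IsTestFunction φ) {u : Eucl N → F}
    (hu : ContDiff ℝ ∞ u) (i : Fin N) :
    ∫ x, coordDeriv i φ x • u x = -∫ x, φ x • coordDeriv i u x := by
  have := integral_smul_fderiv_eq_neg_fderiv_smul_of_integrable (μ := volume) (f := φ) (g := u)
    (v := EuclideanSpace.single i (1 : ℝ))
    (integrable_smul_of_isTestFunction (hφ.coordDeriv i) hu.continuous)
    (integrable_smul_of_isTestFunction hφ (contDiff_coordDeriv hu i).continuous)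
    (integrable_smul_of_isTestFunction hφ hu.continuous)
    (fun x _ => hφ.1.differentiable (by simp) x) (fun x _ => hu.differentiable (by simp) x)
  simp only [coordDeriv]
  rw [this, neg_neg]

theorem integral_partialDeriv_smul {h : ℕ} (I : Fin h → Fin N) {φ : Eucl N → ℝ}
    (hφ : IsTestFunction φ) {u : Eucl N → F} (hu : ContDiff ℝ ∞ u) :
    ∫ x, partialDeriv I φ x • u x = (-1 : ℝ) ^ h • ∫ x, φ x • partialDeriv I u x := by
  induction h generalizing u with
  | zero => simp [partialDeriv_zero]
  | succ h ih =>
    have hcomm : ∀ {h : ℕ} (I : Fin h → Fin N) (i : Fin N), partialDeriv I (coordDeriv i u) =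
        coordDeriv i (partialDeriv I u) := by
      intro h I i
      induction h with
      | zero => rw [partialDeriv_zero, partialDeriv_zero]
      | succ h ih =>
        rw [partialDeriv_succ I hu, partialDeriv_succ I (contDiff_coordDeriv hu i), ih,
          coordDeriv_comm (contDiff_partialDeriv _ hu)]
    rw [partialDeriv_succ I hφ.1, partialDeriv_succ I hu,
      integral_coordDeriv_smul (hφ.partialDeriv _) hu, ih _ (contDiff_coordDeriv hu _), hcomm,
      pow_succ, mul_neg_one, neg_smul]

theorem integral_laplacian_smul {φ : Eucl N → ℝ} (hφ : IsTestFunction φ) {u : Eucl N → F}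
    (hu : ContDiff ℝ ∞ u) :
    ∫ x, Laplacian.laplacian φ x • u x = ∫ x, φ x • Laplacian.laplacian u x := by
  rw [laplacian_eq_sum_coordDeriv hφ.1, laplacian_eq_sum_coordDeriv hu]
  simp only [Finset.sum_smul, Finset.smul_sum]
  rw [integral_finsetSum _ fun i _ => integrable_smul_of_isTestFunction
      ((hφ.coordDeriv i).coordDeriv i) hu.continuous,
    integral_finsetSum _ fun i _ => integrable_smul_of_isTestFunction hφ
      (contDiff_coordDeriv (contDiff_coordDeriv hu i) i).continuous]
  refine Finset.sum_congr rfl fun i _ => ?_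
  rw [integral_coordDeriv_smul (hφ.coordDeriv i) hu,
    integral_coordDeriv_smul hφ (contDiff_coordDeriv hu i), neg_neg]

theorem hasWeakDeriv_partialDeriv {h : ℕ} (I : Fin h → Fin N) {u : Eucl N → ℂ}
    (hu : ContDiff ℝ ∞ u) : HasWeakDeriv I u (partialDeriv I u) :=
  ⟨(contDiff_partialDeriv I hu).continuous.locallyIntegrable, fun _ hφ =>
    integral_partialDeriv_smul I hφ hu⟩

theorem hasWeakBilaplacian_laplacian {u : Eucl N → ℂ} (hu : ContDiff ℝ ∞ u) :
    HasWeakBilaplacian u (Laplacian.laplacian (Laplacian.laplacian u)) :=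
  ⟨(contDiff_laplacian (contDiff_laplacian hu)).continuous.locallyIntegrable, fun φ hφ => by
    rw [integral_laplacian_smul hφ.laplacian hu,
      integral_laplacian_smul hφ (contDiff_laplacian hu)]⟩

/-- The laplacian of a test function has integral zero. -/
theorem integral_laplacian {φ : Eucl N → ℝ} (hφ : IsTestFunction φ) :
    ∫ x, Laplacian.laplacian φ x = 0 := by
  simpa [InnerProductSpace.laplacian_const] using
    integral_laplacian_smul hφ (u := fun _ => (1 : ℝ)) contDiff_const

/-- Testing the weak derivative against `Δ² ψ` moves the derivative onto `ψ` and the bilaplacian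
onto `u`. -/
theorem integral_bilaplacian_smul_weakDeriv {h : ℕ} {I : Fin h → Fin N} {u v w : Eucl N → ℂ}
    (hv : HasWeakDeriv I u v) (hw : HasWeakBilaplacian u w) {ψ : Eucl N → ℝ}
    (hψ : IsTestFunction ψ) :
    ∫ x, Laplacian.laplacian (Laplacian.laplacian ψ) x • v x =
      (-1 : ℝ) ^ h • ∫ x, partialDeriv I ψ x • w x := by
  have h1 := hv.2 _ hψ.laplacian.laplacian
  rw [partialDeriv_laplacian I (contDiff_laplacian hψ.1), partialDeriv_laplacian I hψ.1,
    hw.2 _ (hψ.partialDeriv I)] at h1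
  rw [h1, smul_smul, ← mul_pow]
  simp

end Calculus

/-! ### Radial kernels and the scale-derivative identity -/

section RadialKernel

/-- A smooth profile that vanishes on `(1, ∞)`. -/
structure IsProfile (f : ℝ → ℝ) : Prop where
  contDiff : ContDiff ℝ ∞ f
  eq_zero : ∀ t, 1 < t → f t = 0

/-- The laplacian on `ℝ^N` in the variable `t = |z|²`. -/
def radialLaplacian (N : ℕ) (f : ℝ → ℝ) (t : ℝ) : ℝ :=
  4 * t * deriv (deriv f) t + 2 * N * deriv f t

theorem IsProfile.deriv {f : ℝ → ℝ} (hf : IsProfile f) : IsProfile (deriv f) := by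
  refine ⟨(contDiff_infty_iff_deriv.1 hf.contDiff).2, fun t ht => ?_⟩
  have : f =ᶠ[nhds t] fun _ => 0 := by
    filter_upwards [lt_mem_nhds ht] with r hr using hf.eq_zero r hr
  rw [this.deriv_eq, deriv_const]

theorem IsProfile.radialLaplacian {f : ℝ → ℝ} (hf : IsProfile f) (N : ℕ) :
    IsProfile (radialLaplacian N f) := by
  refine ⟨?_, fun t ht => ?_⟩
  · exact ((contDiff_const.mul contDiff_id).mul hf.deriv.deriv.contDiff).add
      (contDiff_const.mul hf.deriv.contDiff)
  · simp [FourthOrderL1.radialLaplacian, hf.deriv.eq_zero t ht, hf.deriv.deriv.eq_zero t ht]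

/-- There is a profile that is strictly convex on `[0, 1)`. -/
theorem exists_isProfile_convex :
    ∃ g : ℝ → ℝ, IsProfile g ∧ (∀ t, 0 ≤ deriv (deriv g) t) ∧ 0 < deriv (deriv g) 0 := by
  set b : ℝ → ℝ := fun t => expNegInvGlue (1 - t) with hb
  have hbs : ContDiff ℝ ∞ b := expNegInvGlue.contDiff.comp (contDiff_const.sub contDiff_id)
  have hb0 : ∀ t, 1 ≤ t → b t = 0 := fun t ht => expNegInvGlue.zero_of_nonpos (by linarith)
  have prim : ∀ f : ℝ → ℝ, ContDiff ℝ ∞ f → (∀ t, 1 ≤ t → f t = 0) →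
      ContDiff ℝ ∞ (fun t => ∫ r in (1 : ℝ)..t, f r) ∧
        (∀ t, 1 ≤ t → ∫ r in (1 : ℝ)..t, f r = 0) ∧
        deriv (fun t => ∫ r in (1 : ℝ)..t, f r) = f := by
    intro f hf hf0
    have hd : ∀ t, HasDerivAt (fun t => ∫ r in (1 : ℝ)..t, f r) (f t) t := fun t =>
      intervalIntegral.integral_hasDerivAt_right (hf.continuous.intervalIntegrable _ _)
        hf.continuous.stronglyMeasurable.stronglyMeasurableAtFilter hf.continuous.continuousAt
    have hd' : deriv (fun t => ∫ r in (1 : ℝ)..t, f r) = f := funext fun t => (hd t).deriv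
    refine ⟨contDiff_infty_iff_deriv.2 ⟨fun t => (hd t).differentiableAt, by rwa [hd']⟩,
      fun t ht => ?_, hd'⟩
    rw [intervalIntegral.integral_congr (g := fun _ => (0 : ℝ)) fun r hr => ?_]
    · simp
    · rw [Set.uIcc_of_le ht] at hr
      exact hf0 r hr.1
  -- `g` is the second primitive of `b` based at `1`, so it vanishes beyond `1` together with `b`,
  -- and `g'' = b ≥ 0`.
  obtain ⟨h1, h2, h3⟩ := prim b hbs hb0
  obtain ⟨k1, k2, k3⟩ := prim _ h1 h2
  refine ⟨_, ⟨k1, fun t ht => k2 t ht.le⟩, ?_⟩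
  rw [k3, h3]
  exact ⟨fun t => expNegInvGlue.nonneg _, expNegInvGlue.pos_of_pos (by norm_num)⟩

variable {N : ℕ}

/-- The radial function `y ↦ f(|y - x|² / s²)`. -/
def radialKernel (f : ℝ → ℝ) (s : ℝ) (x y : Eucl N) : ℝ := f (‖y - x‖ ^ 2 / s ^ 2)

theorem contDiff_radialKernel {f : ℝ → ℝ} (hf : ContDiff ℝ ∞ f) (s : ℝ) (x : Eucl N) :
    ContDiff ℝ ∞ (radialKernel f s x) :=
  hf.comp (((contDiff_id.sub contDiff_const).norm_sq ℝ).div_const _)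

theorem radialKernel_eq_zero {f : ℝ → ℝ} (hf : IsProfile f) {s : ℝ} (hs : 0 < s)
    {x y : Eucl N} (hy : y ∉ Metric.closedBall x s) : radialKernel f s x y = 0 := by
  refine hf.eq_zero _ ?_
  rw [Metric.mem_closedBall, not_le, dist_eq_norm] at hy
  rw [one_lt_div (by positivity)]
  gcongr

theorem tsupport_radialKernel_subset {f : ℝ → ℝ} (hf : IsProfile f) {s : ℝ} (hs : 0 < s)
    (x : Eucl N) : tsupport (radialKernel f s x) ⊆ Metric.closedBall x s :=
  closure_minimal (fun _ hy => by_contra fun h => hy (radialKernel_eq_zero hf hs h))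
    Metric.isClosed_closedBall

theorem isTestFunction_radialKernel {f : ℝ → ℝ} (hf : IsProfile f) {s : ℝ} (hs : 0 < s)
    (x : Eucl N) : IsTestFunction (radialKernel f s x) :=
  ⟨contDiff_radialKernel hf.contDiff s x, HasCompactSupport.of_support_subset_isCompact
    (isCompact_closedBall x s) ((subset_tsupport _).trans (tsupport_radialKernel_subset hf hs x))⟩

theorem hasFDerivAt_radialKernel {f : ℝ → ℝ} (hf : Differentiable ℝ f) (s : ℝ) (x y : Eucl N) :
    HasFDerivAt (radialKernel f s x)
      ((radialKernel (deriv f) s x y * (2 / s ^ 2)) • innerSL ℝ (y - x)) y := by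
  have h1 : HasFDerivAt (fun y : Eucl N => ‖y - x‖ ^ 2 / s ^ 2)
      ((2 / s ^ 2) • innerSL ℝ (y - x)) y := by
    have := (((hasFDerivAt_id y).sub_const x).norm_sq).mul_const (s ^ 2)⁻¹
    refine (this.congr_fderiv ?_).congr_of_eventuallyEq (.of_forall fun z => ?_)
    · ext v
      simp
      ring
    · simp [div_eq_mul_inv]
  have h2 := (hf (‖y - x‖ ^ 2 / s ^ 2)).hasDerivAt.comp_hasFDerivAt y h1
  rwa [smul_smul] at h2

theorem coordDeriv_radialKernel {f : ℝ → ℝ} (hf : Differentiable ℝ f) (s : ℝ) (x : Eucl N)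
    (i : Fin N) :
    coordDeriv i (radialKernel f s x) =
      fun y => 2 / s ^ 2 * ((y i - x i) * radialKernel (deriv f) s x y) := by
  funext y
  rw [coordDeriv, (hasFDerivAt_radialKernel hf s x y).fderiv]
  simp [PiLp.inner_apply]
  ring

theorem laplacian_radialKernel {f : ℝ → ℝ} (hf : ContDiff ℝ ∞ f) (s : ℝ) (x : Eucl N) :
    Laplacian.laplacian (radialKernel f s x) =
      fun y => (s ^ 2)⁻¹ * radialKernel (radialLaplacian N f) s x y := by
  have hf' := contDiff_infty_iff_deriv.1 hf
  have hf'' := contDiff_infty_iff_deriv.1 hf'.2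
  funext y
  have key : ∀ i, coordDeriv i (coordDeriv i (radialKernel f s x)) y =
      2 / s ^ 2 * radialKernel (deriv f) s x y +
        4 / s ^ 4 * radialKernel (deriv (deriv f)) s x y * (y i - x i) ^ 2 := by
    intro i
    rw [coordDeriv_radialKernel hf'.1, coordDeriv]
    have h1 : HasFDerivAt (fun y : Eucl N => y i - x i)
        (EuclideanSpace.proj i : Eucl N →L[ℝ] ℝ) y :=
      (EuclideanSpace.proj i : Eucl N →L[ℝ] ℝ).hasFDerivAt.sub_const _
    have h2 := (h1.mul (hasFDerivAt_radialKernel hf''.1 s x y)).const_mul (2 / s ^ 2)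
    refine (congrArg (fun L => L (EuclideanSpace.single i (1 : ℝ))) h2.fderiv).trans ?_
    simp [PiLp.inner_apply]
    ring
  have hsum : ∑ i, (y i - x i) ^ 2 = ‖y - x‖ ^ 2 := by
    rw [EuclideanSpace.norm_sq_eq]
    simp
  rw [laplacian_eq_sum_coordDeriv (contDiff_radialKernel hf s x)]
  simp only [key]
  rw [Finset.sum_add_distrib, ← Finset.mul_sum, ← Finset.mul_sum, hsum]
  simp only [radialKernel, radialLaplacian, Finset.sum_const, Finset.card_univ, Fintype.card_fin,
    nsmul_eq_mul]
  ring

theorem bilaplacian_radialKernel {f : ℝ → ℝ} (hf : IsProfile f) {s : ℝ} (hs : 0 < s)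
    (x : Eucl N) :
    Laplacian.laplacian (Laplacian.laplacian (radialKernel f s x)) =
      fun y => (s ^ 4)⁻¹ * radialKernel (radialLaplacian N (radialLaplacian N f)) s x y := by
  rw [laplacian_radialKernel hf.contDiff]
  have hL := hf.radialLaplacian N
  funext y
  have := InnerProductSpace.laplacian_smul ((s ^ 2)⁻¹)
    ((contDiff_radialKernel hL.contDiff s x).contDiffAt (x := y) |>.of_le
      (WithTop.coe_le_coe.2 le_top : ((2 : ℕ∞) : WithTop ℕ∞) ≤ ((⊤ : ℕ∞) : WithTop ℕ∞)))
  rw [laplacian_radialKernel hL.contDiff] at this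
  refine this.trans ?_
  simp only [smul_eq_mul]
  field_simp

/-- The kernel at scale `s` is the fixed compactly supported function `radialKernel f 1 0` composed
with `y ↦ s⁻¹(y - x)`, so each derivative costs a factor `s⁻¹` and `C` depends on neither `s` nor
`x`. -/
theorem exists_abs_partialDeriv_radialKernel_le {f : ℝ → ℝ} (hf : IsProfile f) (N h : ℕ) :
    ∃ C : ℝ, 0 ≤ C ∧ ∀ (I : Fin h → Fin N) (s : ℝ) (x y : Eucl N), 0 < s →
      |partialDeriv I (radialKernel f s x) y| ≤
        (Metric.closedBall x s).indicator (fun _ => C * (s ^ h)⁻¹) y := by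
  have hF := isTestFunction_radialKernel hf one_pos (0 : Eucl N)
  have hle : ((h : ℕ∞) : WithTop ℕ∞) ≤ ((⊤ : ℕ∞) : WithTop ℕ∞) := WithTop.coe_le_coe.2 le_top
  obtain ⟨C, hC⟩ := (hF.1.continuous_iteratedFDeriv (m := h) hle).bounded_above_of_compact_support
    (hF.2.iteratedFDeriv (𝕜 := ℝ) h)
  refine ⟨C, (norm_nonneg _).trans (hC 0), fun I s x y hs => ?_⟩
  by_cases hy : y ∈ Metric.closedBall x s
  · rw [Set.indicator_of_mem hy]
    have e : radialKernel f s x =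
        fun y => (radialKernel f 1 0 ∘ (s⁻¹ • ContinuousLinearMap.id ℝ (Eucl N))) (y - x) := by
      funext z
      simp [radialKernel, norm_smul, mul_pow, abs_of_pos hs, div_eq_mul_inv, mul_comm]
    rw [partialDeriv, e, iteratedFDeriv_comp_sub,
      ContinuousLinearMap.iteratedFDeriv_comp_right _ hF.1 _ hle, ← Real.norm_eq_abs]
    refine (ContinuousMultilinearMap.le_opNorm _ _).trans ?_
    refine le_trans (b := ‖iteratedFDeriv ℝ h (radialKernel f 1 0)
      ((s⁻¹ • ContinuousLinearMap.id ℝ (Eucl N)) (y - x))‖ * (s⁻¹) ^ h) ?_ ?_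
    · rw [Finset.prod_eq_one fun i _ => by simp, mul_one]
      refine ContinuousMultilinearMap.norm_compContinuousLinearMap_le _ _ |>.trans ?_
      gcongr
      simp only [Finset.prod_const, Finset.card_univ, Fintype.card_fin]
      gcongr
      refine (norm_smul_le _ _).trans ?_
      rw [Real.norm_of_nonneg (by positivity)]
      exact mul_le_of_le_one_right (by positivity) ContinuousLinearMap.norm_id_le
    · rw [inv_pow]
      gcongr
      exact hC _
  · rw [Set.indicator_of_notMem hy]
    have : y ∉ tsupport (iteratedFDeriv ℝ h (radialKernel f s x)) := fun h' =>
      hy (tsupport_radialKernel_subset hf hs x (tsupport_iteratedFDeriv_subset h h'))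
    rw [partialDeriv, image_eq_zero_of_notMem_tsupport this]
    simp

/-- With `p = (L g)'` and `t = |y-x|²/s²`, the `s`-derivative is `-s⁻ᴺ⁻¹ (N p + 2t p')`. The bracket
is half of `L(L g) = 4t p' + 2N p`, and the bilaplacian of the kernel of `g` is `s⁻⁴ L(L g)`. -/
theorem hasDerivAt_radialKernel {g : ℝ → ℝ} (hg : IsProfile g) {s : ℝ} (hs : 0 < s)
    (x y : Eucl N) :
    HasDerivAt (fun s => (s ^ N)⁻¹ * radialKernel (deriv (radialLaplacian N g)) s x y)
      (-(s ^ 3 * (s ^ N)⁻¹ / 2 *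
        Laplacian.laplacian (Laplacian.laplacian (radialKernel g s x)) y)) s := by
  have hp := ((hg.radialLaplacian N).deriv.contDiff.differentiable (by simp)
    (‖y - x‖ ^ 2 / s ^ 2)).hasDerivAt
  have hq : HasDerivAt (fun s : ℝ => ‖y - x‖ ^ 2 / s ^ 2) (-(2 * ‖y - x‖ ^ 2 / s ^ 3)) s := by
    have := (hasDerivAt_const s (‖y - x‖ ^ 2)).div (hasDerivAt_pow 2 s) (by positivity)
    refine this.congr_deriv ?_
    field_simp
    push_cast
    ring
  have hN : HasDerivAt (fun s : ℝ => (s ^ N)⁻¹) (-(N * (s ^ N)⁻¹ * s⁻¹)) s := by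
    have := (hasDerivAt_pow N s).inv (by positivity)
    refine this.congr_deriv ?_
    rcases N with _ | n
    · simp
    · simp only [Nat.add_sub_cancel]
      field_simp
      ring
  refine (hN.mul (hp.comp s hq)).congr_deriv ?_
  rw [bilaplacian_radialKernel hg hs]
  simp only [radialKernel, Function.comp]
  rw [radialLaplacian]
  field_simp
  ring

theorem integral_radialKernel (f : ℝ → ℝ) {s : ℝ} (hs : 0 < s) (x : Eucl N) :
    ∫ y, radialKernel f s x y = s ^ N * ∫ y : Eucl N, radialKernel f 1 0 y := by
  have h1 : ∫ y, radialKernel f s x y = ∫ y : Eucl N, radialKernel f s 0 y := by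
    rw [← integral_sub_right_eq_self (fun y => radialKernel f s 0 y) x]
    simp [radialKernel]
  have h2 := Measure.integral_comp_inv_smul (volume : Measure (Eucl N))
    (fun y => radialKernel f 1 0 y) s
  have h3 : ∀ y : Eucl N, radialKernel f s 0 y = radialKernel f 1 0 (s⁻¹ • y) := fun y => by
    simp [radialKernel, norm_smul, mul_pow, abs_of_pos hs, div_eq_mul_inv, mul_comm]
  simp only [h1, h3]
  rw [h2]
  simp [abs_of_pos hs]

/-- Since `(L g)' = 4 g'' + L(g')` and the second term yields the laplacian of a test function, with
integral zero, the mass is `4 ∫ g''(|y|²)`. Convexity of `g` is needed here. -/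
theorem integral_radialKernel_deriv_radialLaplacian_pos {g : ℝ → ℝ} (hg : IsProfile g)
    (hg2 : ∀ t, 0 ≤ deriv (deriv g) t) (hg0 : 0 < deriv (deriv g) 0) (N : ℕ) :
    0 < ∫ y : Eucl N, radialKernel (deriv (radialLaplacian N g)) 1 0 y := by
  have e : ∀ y : Eucl N, radialKernel (deriv (radialLaplacian N g)) 1 0 y =
      4 * radialKernel (deriv (deriv g)) 1 0 y +
        Laplacian.laplacian (radialKernel (deriv g) 1 0) y := by
    intro y
    rw [laplacian_radialKernel hg.deriv.contDiff]
    have hd : ∀ t, deriv (radialLaplacian N g) t =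
        4 * deriv (deriv g) t + radialLaplacian N (deriv g) t := by
      intro t
      have h1 := (hg.deriv.contDiff.differentiable (by simp) t).hasDerivAt
      have h2 := (hg.deriv.deriv.contDiff.differentiable (by simp) t).hasDerivAt
      have h3 := ((((hasDerivAt_id t).const_mul 4).mul h2).add (h1.const_mul (2 * (N : ℝ)))).deriv
      refine h3.trans ?_
      simp [radialLaplacian]
      ring
    simp [radialKernel, hd]
  have t1 := isTestFunction_radialKernel hg.deriv.deriv one_pos (0 : Eucl N)
  have t2 := (isTestFunction_radialKernel hg.deriv one_pos (0 : Eucl N)).laplacian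
  simp only [e]
  rw [integral_add ((t1.1.continuous.integrable_of_hasCompactSupport t1.2).const_mul 4)
    (t2.1.continuous.integrable_of_hasCompactSupport t2.2),
    integral_laplacian (isTestFunction_radialKernel hg.deriv one_pos (0 : Eucl N)), add_zero,
    integral_const_mul]
  refine mul_pos (by norm_num) (t1.1.continuous.integral_pos_of_hasCompactSupport_nonneg_nonzero
    t1.2 (fun y => hg2 _) (x := 0) ?_)
  simpa [radialKernel] using hg0.ne'

end RadialKernel

/-! ### Pointwise representation of weak derivatives -/

section Representation

open Filter Topology Metric

variable {N : ℕ}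

theorem IsTestFunction.integrable_smul {φ : Eucl N → ℝ} (hφ : IsTestFunction φ)
    {v : Eucl N → ℂ} (hv : LocallyIntegrable v volume) : Integrable (fun y => φ y • v y) :=
  hv.integrable_smul_left_of_hasCompactSupport hφ.1.continuous hφ.2

theorem IsProfile.exists_abs_radialKernel_le {f : ℝ → ℝ} (hf : IsProfile f) (N : ℕ) :
    ∃ C : ℝ, 0 ≤ C ∧ ∀ (s : ℝ) (x y : Eucl N), 0 < s →
      |radialKernel f s x y| ≤ (closedBall x s).indicator (fun _ => C) y := by
  obtain ⟨C, hC0, hC⟩ := exists_abs_partialDeriv_radialKernel_le hf N 0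
  refine ⟨C, hC0, fun s x y hs => ?_⟩
  simpa [partialDeriv_zero] using hC Fin.elim0 s x y hs

/-- The mollification of `v` at scale `s` (up to normalisation) by the kernel whose `s`-derivative
is a bilaplacian. -/
def radialMean (g : ℝ → ℝ) (v : Eucl N → ℂ) (x : Eucl N) (s : ℝ) : ℂ :=
  ∫ y, ((s ^ N)⁻¹ * radialKernel (deriv (radialLaplacian N g)) s x y) • v y

/-- Differentiation under the integral: for scales in `(s/2, 2s)` all kernels live in the ball of
radius `2s`, where `v` is integrable. -/
theorem hasDerivAt_radialMean {g : ℝ → ℝ} (hg : IsProfile g) {v : Eucl N → ℂ}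
    (hv : LocallyIntegrable v volume) (x : Eucl N) {s : ℝ} (hs : 0 < s) :
    HasDerivAt (radialMean g v x) (∫ y, (-(s ^ 3 * (s ^ N)⁻¹ / 2 *
      Laplacian.laplacian (Laplacian.laplacian (radialKernel g s x)) y)) • v y) s := by
  obtain ⟨C, hC0, hC⟩ := ((hg.radialLaplacian N).radialLaplacian N).exists_abs_radialKernel_le N
  have hp := (hg.radialLaplacian N).deriv
  have hint : ∀ t, 0 < t → Integrable
      (fun y => ((t ^ N)⁻¹ * radialKernel (deriv (radialLaplacian N g)) t x y) • v y) := by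
    intro t ht
    refine (((isTestFunction_radialKernel hp ht x).integrable_smul hv).smul ((t ^ N)⁻¹)).congr
      (.of_forall fun y => ?_)
    simp only [Pi.smul_apply, mul_smul]
  have hint' : Integrable (fun y => (-(s ^ 3 * (s ^ N)⁻¹ / 2 *
      Laplacian.laplacian (Laplacian.laplacian (radialKernel g s x)) y)) • v y) := by
    refine (((isTestFunction_radialKernel hg hs x).laplacian.laplacian.integrable_smul hv).smul
      (-(s ^ 3 * (s ^ N)⁻¹ / 2))).congr (.of_forall fun y => ?_)
    simp only [Pi.smul_apply, neg_smul, mul_smul]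
  -- Each power of `t` is bounded at the worse endpoint of `(s/2, 2s)`: positive powers at `2s`,
  -- negative ones at `s/2`.
  set K : ℝ := (2 * s) ^ 3 * ((s / 2) ^ N)⁻¹ / 2 * (((s / 2) ^ 4)⁻¹ * C) with hK
  have hK0 : 0 ≤ K := by positivity
  refine (hasDerivAt_integral_of_dominated_loc_of_deriv_le
    (F' := fun t y => (-(t ^ 3 * (t ^ N)⁻¹ / 2 *
      Laplacian.laplacian (Laplacian.laplacian (radialKernel g t x)) y)) • v y)
    (bound := (closedBall x (2 * s)).indicator fun y => K * ‖v y‖)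
    (Ioo_mem_nhds (half_lt_self hs) (by linarith : s < 2 * s)) ?_ (hint s hs) hint'.1 ?_ ?_ ?_).2
  · filter_upwards [lt_mem_nhds hs] with t ht using (hint t ht).1
  · refine .of_forall fun y t ht => ?_
    have ht0 : 0 < t := (half_pos hs).trans ht.1
    rw [bilaplacian_radialKernel hg ht0]
    have h1 := hC t x y ht0
    by_cases hy : y ∈ closedBall x (2 * s)
    · rw [Set.indicator_of_mem hy, norm_smul]
      gcongr
      have h2 : |radialKernel (radialLaplacian N (radialLaplacian N g)) t x y| ≤ C :=
        h1.trans (Set.indicator_le_self' (fun _ _ => hC0) y)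
      rw [norm_neg, norm_mul, norm_mul, Real.norm_of_nonneg (by positivity),
        Real.norm_of_nonneg (by positivity), Real.norm_eq_abs, hK]
      have := ht.1.le
      have := ht.2.le
      gcongr
    · have hy' : y ∉ closedBall x t := fun h =>
        hy (closedBall_subset_closedBall ht.2.le h)
      rw [Set.indicator_of_notMem hy', abs_nonpos_iff] at h1
      rw [Set.indicator_of_notMem hy]
      simp [h1]
  · refine (integrable_indicator_iff measurableSet_closedBall).2 ?_
    exact (hv.integrableOn_isCompact (isCompact_closedBall _ _)).norm.const_mul _
  · refine .of_forall fun y t ht => ?_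
    exact (hasDerivAt_radialKernel hg ((half_pos hs).trans ht.1) x y).smul_const (v y)

theorem enorm_integral_smul_le {k : Eucl N → ℝ} {C : ℝ} {x : Eucl N} {s : ℝ}
    (hk : ∀ y, |k y| ≤ (closedBall x s).indicator (fun _ => C) y) (u : Eucl N → ℂ) :
    ‖∫ y, k y • u y‖ₑ ≤ ENNReal.ofReal C * ∫⁻ y in closedBall x s, ‖u y‖ₑ := by
  refine (enorm_integral_le_lintegral_enorm _).trans ?_
  rw [← lintegral_const_mul' _ _ ENNReal.ofReal_ne_top,
    ← lintegral_indicator measurableSet_closedBall]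
  refine lintegral_mono fun y => ?_
  have h := hk y
  by_cases hy : y ∈ closedBall x s
  · rw [Set.indicator_of_mem hy] at h ⊢
    rw [enorm_smul, ← ofReal_norm (k y)]
    gcongr
    exact h
  · rw [Set.indicator_of_notMem hy, abs_nonpos_iff] at h
    simp [h]

/-- The weak derivative is moved onto the kernel, where order `h` costs `s⁻ʰ`. -/
theorem exists_enorm_radialMean_le {g : ℝ → ℝ} (hg : IsProfile g) (N h : ℕ) :
    ∃ C : ℝ, 0 ≤ C ∧ ∀ (I : Fin h → Fin N) (u v : Eucl N → ℂ), HasWeakDeriv I u v →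
      ∀ (x : Eucl N) (s : ℝ), 0 < s → ‖radialMean g v x s‖ₑ ≤
        ENNReal.ofReal (C * ((s ^ N)⁻¹ * (s ^ h)⁻¹)) * ∫⁻ y in closedBall x s, ‖u y‖ₑ := by
  have hp := (hg.radialLaplacian N).deriv
  obtain ⟨C, hC0, hC⟩ := exists_abs_partialDeriv_radialKernel_le hp N h
  refine ⟨C, hC0, fun I u v hv x s hs => ?_⟩
  have h1 : radialMean g v x s = (-1 : ℝ) ^ h • ∫ y, ((s ^ N)⁻¹ * partialDeriv I
      (radialKernel (deriv (radialLaplacian N g)) s x) y) • u y := by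
    simp only [radialMean, mul_smul]
    rw [integral_smul, integral_smul, hv.2 _ (isTestFunction_radialKernel hp hs x), smul_comm,
      smul_smul ((-1 : ℝ) ^ h), ← mul_pow]
    simp
  rw [h1, enorm_smul]
  have h2 : ‖(-1 : ℝ) ^ h‖ₑ = 1 := by simp [enorm_eq_nnnorm]
  rw [h2, one_mul]
  refine enorm_integral_smul_le (fun y => ?_) u
  have := hC I s x y hs
  rw [abs_mul, abs_of_nonneg (by positivity : 0 ≤ (s ^ N)⁻¹)]
  by_cases hy : y ∈ closedBall x s
  · rw [Set.indicator_of_mem hy] at this ⊢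
    calc _ ≤ (s ^ N)⁻¹ * (C * (s ^ h)⁻¹) := by gcongr
      _ = _ := by ring
  · rw [Set.indicator_of_notMem hy] at this ⊢
    rw [abs_nonpos_iff.1 this]
    simp

/-- The `s`-derivative of the kernel is a bilaplacian, so `Δ²` can be exchanged against `D_I`: the
kernel takes the `h` derivatives and `u` takes `Δ²`. -/
theorem exists_enorm_deriv_radialMean_le {g : ℝ → ℝ} (hg : IsProfile g) (N h : ℕ) :
    ∃ C : ℝ, 0 ≤ C ∧ ∀ (I : Fin h → Fin N) (u v w : Eucl N → ℂ), HasWeakDeriv I u v →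
      HasWeakBilaplacian u w → ∀ (x : Eucl N) (s : ℝ), 0 < s →
        ‖deriv (radialMean g v x) s‖ₑ ≤
          ENNReal.ofReal (C * (s ^ 3 * (s ^ N)⁻¹ * (s ^ h)⁻¹)) *
            ∫⁻ y in closedBall x s, ‖w y‖ₑ := by
  obtain ⟨C, hC0, hC⟩ := exists_abs_partialDeriv_radialKernel_le hg N h
  refine ⟨C, hC0, fun I u v w hv hw x s hs => ?_⟩
  have h1 : deriv (radialMean g v x) s = (-(-1 : ℝ) ^ h) •
      ∫ y, (s ^ 3 * (s ^ N)⁻¹ / 2 * partialDeriv I (radialKernel g s x) y) • w y := by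
    rw [(hasDerivAt_radialMean hg hv.1 x hs).deriv]
    simp only [neg_smul, mul_smul]
    rw [integral_neg, integral_smul, integral_smul,
      integral_bilaplacian_smul_weakDeriv hv hw (isTestFunction_radialKernel hg hs x), smul_comm]
  rw [h1, enorm_smul]
  have h2 : ‖-(-1 : ℝ) ^ h‖ₑ = 1 := by simp [enorm_eq_nnnorm]
  rw [h2, one_mul]
  refine enorm_integral_smul_le (fun y => ?_) w
  have := hC I s x y hs
  rw [abs_mul, abs_of_nonneg (by positivity : 0 ≤ s ^ 3 * (s ^ N)⁻¹ / 2)]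
  by_cases hy : y ∈ closedBall x s
  · rw [Set.indicator_of_mem hy] at this ⊢
    have h3 : s ^ 3 * (s ^ N)⁻¹ / 2 ≤ s ^ 3 * (s ^ N)⁻¹ := half_le_self (by positivity)
    calc _ ≤ s ^ 3 * (s ^ N)⁻¹ * (C * (s ^ h)⁻¹) := by gcongr
      _ = _ := by ring
  · rw [Set.indicator_of_notMem hy] at this ⊢
    rw [abs_nonpos_iff.1 this]
    simp

/-- Lebesgue differentiation: the normalised kernels have integral one, are supported in the balls
of radius `s`, and are bounded by a constant over the volume of these balls. -/
theorem ae_tendsto_radialMean {g : ℝ → ℝ} (hg : IsProfile g)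
    (hm : 0 < ∫ y : Eucl N, radialKernel (deriv (radialLaplacian N g)) 1 0 y) {v : Eucl N → ℂ}
    (hv : LocallyIntegrable v volume) :
    ∀ᵐ x, Tendsto (fun s => (∫ y : Eucl N,
      radialKernel (deriv (radialLaplacian N g)) 1 0 y)⁻¹ • radialMean g v x s) (𝓝[>] 0)
        (𝓝 (v x)) := by
  have hp := (hg.radialLaplacian N).deriv
  obtain ⟨C, hC0, hC⟩ := hp.exists_abs_radialKernel_le N
  set m := ∫ y : Eucl N, radialKernel (deriv (radialLaplacian N g)) 1 0 y
  filter_upwards [(Besicovitch.vitaliFamily volume).ae_tendsto_average_norm_sub hv] with x hx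
  have e : ∀ s, m⁻¹ • radialMean g v x s = ∫ y, (m⁻¹ * ((s ^ N)⁻¹ *
      radialKernel (deriv (radialLaplacian N g)) s x y)) • v y := by
    intro s
    rw [radialMean, ← integral_smul]
    simp only [smul_smul]
  simp only [e]
  have hpos : ∀ᶠ s : ℝ in 𝓝[>] 0, 0 < s := self_mem_nhdsWithin
  refine tendsto_integral_smul_of_tendsto_average_norm_sub (a := fun s => closedBall x s)
    (m⁻¹ * C * (volume : Measure (Eucl N)).real (closedBall 0 1))
    (hx.comp (Besicovitch.tendsto_filterAt volume x)) ?_ ?_ ?_ ?_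
  · filter_upwards with s using hv.integrableOn_isCompact (isCompact_closedBall _ _)
  · refine tendsto_const_nhds.congr' ?_
    filter_upwards [hpos] with s hs
    rw [integral_const_mul, integral_const_mul, integral_radialKernel _ hs]
    rw [← mul_assoc, ← mul_assoc, mul_assoc m⁻¹, inv_mul_cancel₀ (pow_pos hs N).ne', mul_one,
      inv_mul_cancel₀ hm.ne']
  · filter_upwards [hpos] with s hs y hy
    by_contra h
    exact hy (by simp [radialKernel_eq_zero hp hs h])
  · filter_upwards [hpos] with s hs y
    have h1 : |radialKernel (deriv (radialLaplacian N g)) s x y| ≤ C :=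
      (hC s x y hs).trans (Set.indicator_le_self' (fun _ _ => hC0) y)
    have h2 : 0 < (volume : Measure (Eucl N)).real (closedBall 0 1) :=
      ENNReal.toReal_pos (measure_closedBall_pos _ _ one_pos).ne' measure_closedBall_lt_top.ne
    rw [Measure.addHaar_real_closedBall' _ _ hs.le, finrank_euclideanSpace_fin, abs_mul, abs_mul,
      abs_of_nonneg (by positivity : 0 ≤ m⁻¹), abs_of_nonneg (by positivity : 0 ≤ (s ^ N)⁻¹)]
    calc _ ≤ m⁻¹ * ((s ^ N)⁻¹ * C) := by gcongr
      _ = _ := by field_simp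

theorem enorm_le_add_lintegral_deriv {f : ℝ → ℂ} {δ r : ℝ} (hδr : δ ≤ r)
    (hf : ∀ s ∈ Set.Icc δ r, DifferentiableAt ℝ f s) :
    ‖f δ‖ₑ ≤ ‖f r‖ₑ + ∫⁻ s in Set.Ioc δ r, ‖deriv f s‖ₑ := by
  -- An infinite right side leaves nothing to prove; a finite one makes the derivative integrable,
  -- as the fundamental theorem of calculus requires.
  by_cases htop : ∫⁻ s in Set.Ioc δ r, ‖deriv f s‖ₑ = ⊤
  · simp [htop]
  have hint : IntervalIntegrable (deriv f) volume δ r := by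
    rw [intervalIntegrable_iff_integrableOn_Ioc_of_le hδr]
    exact ⟨(measurable_deriv f).aestronglyMeasurable, lt_top_iff_ne_top.2 htop⟩
  have h := intervalIntegral.integral_eq_sub_of_hasDerivAt
    (fun s hs => (hf s (by rwa [Set.uIcc_of_le hδr] at hs)).hasDerivAt) hint
  have e : f δ = f r - ∫ s in δ..r, deriv f s := by rw [h]; ring
  rw [e]
  refine enorm_sub_le.trans ?_
  gcongr
  rw [intervalIntegral.integral_of_le hδr]
  exact enorm_integral_le_lintegral_enorm _

/-- Pointwise a.e. bound of weak derivatives by local averages of `u` and of its bilaplacian. -/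
theorem exists_enorm_weakDeriv_le (N h : ℕ) :
    ∃ K : ℝ, 0 ≤ K ∧ ∀ (I : Fin h → Fin N) (u v w : Eucl N → ℂ), HasWeakDeriv I u v →
      HasWeakBilaplacian u w → ∀ᵐ x, ∀ r : ℝ, 0 < r →
        ‖v x‖ₑ ≤ ENNReal.ofReal (K * ((r ^ N)⁻¹ * (r ^ h)⁻¹)) *
            (∫⁻ y in closedBall x r, ‖u y‖ₑ) +
          ∫⁻ s in Set.Ioc 0 r, ENNReal.ofReal (K * (s ^ 3 * (s ^ N)⁻¹ * (s ^ h)⁻¹)) *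
            ∫⁻ y in closedBall x s, ‖w y‖ₑ := by
  obtain ⟨g, hg, hg2, hg0⟩ := exists_isProfile_convex
  have hm := integral_radialKernel_deriv_radialLaplacian_pos hg hg2 hg0 N
  obtain ⟨C₁, hC₁, hu⟩ := exists_enorm_radialMean_le hg N h
  obtain ⟨C₂, hC₂, hw⟩ := exists_enorm_deriv_radialMean_le hg N h
  set m := ∫ y : Eucl N, radialKernel (deriv (radialLaplacian N g)) 1 0 y with hmdef
  refine ⟨m⁻¹ * (C₁ + C₂), by positivity, fun I u v w hv hvw => ?_⟩
  -- The exceptional set is fixed before `r`, so `r` may later depend on `x`. The bound is proved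
  -- for the means at scale `δ < r`, uniformly in `δ`, and passes to the limit `δ → 0`.
  filter_upwards [ae_tendsto_radialMean hg hm hv.1] with x hx r hr
  have hm' : ‖m⁻¹‖ₑ = ENNReal.ofReal m⁻¹ := Real.enorm_of_nonneg (by positivity)
  refine le_of_tendsto (hx.enorm) ?_
  filter_upwards [Ioo_mem_nhdsGT hr] with δ hδ
  rw [enorm_smul, hm']
  have h1 := enorm_le_add_lintegral_deriv hδ.2.le fun s hs =>
    (hasDerivAt_radialMean hg hv.1 x (hδ.1.trans_le hs.1)).differentiableAt
  refine (mul_le_mul' le_rfl h1).trans ?_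
  rw [mul_add]
  refine add_le_add ?_ ?_
  · refine (mul_le_mul' le_rfl (hu I u v hv x r hr)).trans ?_
    rw [← mul_assoc, ← ENNReal.ofReal_mul (by positivity), mul_assoc m⁻¹]
    gcongr
    exact le_add_of_nonneg_right hC₂
  · rw [← lintegral_const_mul' _ _ ENNReal.ofReal_ne_top]
    refine le_trans ?_ (lintegral_mono_set (Set.Ioc_subset_Ioc_left hδ.1.le))
    refine setLIntegral_mono' measurableSet_Ioc fun s hs => ?_
    have hs0 := hδ.1.trans hs.1
    refine (mul_le_mul' le_rfl (hw I u v w hv hvw x s hs0)).trans ?_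
    rw [← mul_assoc, ← ENNReal.ofReal_mul (by positivity), mul_assoc m⁻¹]
    gcongr
    exact le_add_of_nonneg_left hC₁

end Representation

/-! ### Integration of the pointwise bound at a slowly varying scale -/

section VariableScale

open Metric

/-- The `L¹` Schur test: after Tonelli only the integrals of the kernel in `x` for fixed `y` matter.
-/
theorem lintegral_lintegral_mul_le {α β : Type*} [MeasurableSpace α] [MeasurableSpace β]
    {μ : Measure α} {ν : Measure β} [SFinite μ] [SFinite ν] {k : α × β → ℝ≥0∞}
    (hk : Measurable k) {W : β → ℝ≥0∞} (hW : AEMeasurable W ν) {c : β → ℝ≥0∞}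
    (hc : ∀ y, ∫⁻ x, k (x, y) ∂μ ≤ c y) :
    ∫⁻ x, ∫⁻ y, k (x, y) * W y ∂ν ∂μ ≤ ∫⁻ y, c y * W y ∂ν := by
  rw [lintegral_lintegral_swap (hk.aemeasurable.mul hW.comp_snd)]
  refine lintegral_mono fun y => ?_
  rw [lintegral_mul_const _ (show Measurable fun x => k (x, y) from
    hk.comp measurable_prodMk_right)]
  gcongr
  exact hc y

variable {N : ℕ}

/-- The volume of the unit ball of `ℝ^N`. -/
def unitBallVolume (N : ℕ) : ℝ := (volume : Measure (Eucl N)).real (closedBall 0 1)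

theorem unitBallVolume_nonneg (N : ℕ) : 0 ≤ unitBallVolume N := ENNReal.toReal_nonneg

theorem volume_closedBall_eq (x : Eucl N) {r : ℝ} (hr : 0 ≤ r) :
    volume (closedBall x r) = ENNReal.ofReal (r ^ N * unitBallVolume N) := by
  rw [Measure.addHaar_closedBall' _ _ hr, finrank_euclideanSpace_fin,
    ENNReal.ofReal_mul (by positivity), unitBallVolume,
    ofReal_measureReal measure_closedBall_lt_top.ne]

/-- A positive scale function that varies slowly on balls of radius `ε ρ`. -/
structure IsSlowScale (ρ : Eucl N → ℝ) (ε : ℝ) : Prop where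
  pos : ∀ x, 0 < ρ x
  continuous : Continuous ρ
  eps_pos : 0 < ε
  le_two_mul : ∀ x y, dist y x ≤ ε * ρ x → ρ x ≤ 2 * ρ y ∧ ρ y ≤ 2 * ρ x

/-- The kernel of the average of a function over `closedBall x (ε ρ(x))` with weight `c`. -/
def ballKernel (ρ : Eucl N → ℝ) (ε : ℝ) (c : ℝ → ℝ) : Eucl N × Eucl N → ℝ≥0∞ :=
  {p | dist p.2 p.1 ≤ ε * ρ p.1}.indicator fun p => ENNReal.ofReal (c (ρ p.1))

theorem ballKernel_of_le {ρ : Eucl N → ℝ} {ε : ℝ} (c : ℝ → ℝ) {x y : Eucl N}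
    (h : dist y x ≤ ε * ρ x) : ballKernel ρ ε c (x, y) = ENNReal.ofReal (c (ρ x)) :=
  Set.indicator_of_mem (s := {p : Eucl N × Eucl N | dist p.2 p.1 ≤ ε * ρ p.1}) (a := (x, y)) h _

theorem ballKernel_of_not_le {ρ : Eucl N → ℝ} {ε : ℝ} (c : ℝ → ℝ) {x y : Eucl N}
    (h : ¬dist y x ≤ ε * ρ x) : ballKernel ρ ε c (x, y) = 0 :=
  Set.indicator_of_notMem (s := {p : Eucl N × Eucl N | dist p.2 p.1 ≤ ε * ρ p.1}) (a := (x, y)) h _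

theorem measurable_ballKernel {ρ : Eucl N → ℝ} (hρ : Continuous ρ) (ε : ℝ) {c : ℝ → ℝ}
    (hc : Measurable c) : Measurable (ballKernel ρ ε c) := by
  have h1 : Measurable ρ := hρ.measurable
  refine Measurable.indicator (by fun_prop) (measurableSet_le (by fun_prop) (by fun_prop))

theorem lintegral_ballKernel_mul (ρ : Eucl N → ℝ) (ε : ℝ) (c : ℝ → ℝ) (x : Eucl N)
    (U : Eucl N → ℝ≥0∞) :
    ∫⁻ y, ballKernel ρ ε c (x, y) * U y =
      ENNReal.ofReal (c (ρ x)) * ∫⁻ y in closedBall x (ε * ρ x), U y := by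
  rw [← lintegral_const_mul' _ _ ENNReal.ofReal_ne_top,
    ← lintegral_indicator measurableSet_closedBall]
  refine lintegral_congr fun y => ?_
  by_cases hy : dist y x ≤ ε * ρ x
  · rw [Set.indicator_of_mem (mem_closedBall.2 hy), ballKernel_of_le c hy]
  · rw [Set.indicator_of_notMem (fun h => hy (mem_closedBall.1 h)), ballKernel_of_not_le c hy,
      zero_mul]

/-- For fixed `y`, slow variation confines `x` to the ball of radius `2ερ(y)` and gives `ρ(x) ≥
ρ(y)/2` there. The ratio of the radii `2ερ(y)` and `ερ(y)/2` produces `4ᴺ`; the powers `ρʰ` cancel.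
-/
theorem IsSlowScale.lintegral_ballKernel_le {ρ : Eucl N → ℝ} {ε : ℝ} (hρ : IsSlowScale ρ ε)
    {K : ℝ} (hK : 0 ≤ K) (h : ℕ) (y : Eucl N) :
    ∫⁻ x, ballKernel ρ ε (fun t => t ^ h * (K * (((ε * t) ^ N)⁻¹ * ((ε * t) ^ h)⁻¹))) (x, y) ≤
      ENNReal.ofReal (K * (4 ^ N * unitBallVolume N) * (ε ^ h)⁻¹) := by
  have hε := hρ.eps_pos
  have hy0 := hρ.pos y
  calc _ ≤ ∫⁻ x, (closedBall y (2 * (ε * ρ y))).indicator (fun _ =>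
        ENNReal.ofReal (K * (ε ^ h)⁻¹ * ((ε * ρ y / 2) ^ N)⁻¹)) x := by
        refine lintegral_mono fun x => ?_
        by_cases hx : dist y x ≤ ε * ρ x
        · obtain ⟨h1, h2⟩ := hρ.le_two_mul x y hx
          have hx0 := hρ.pos x
          have hmem : x ∈ closedBall y (2 * (ε * ρ y)) := by
            rw [mem_closedBall']
            nlinarith
          rw [Set.indicator_of_mem hmem, ballKernel_of_le _ hx]
          refine ENNReal.ofReal_le_ofReal ?_
          have h3 : ((ε * ρ x) ^ N)⁻¹ ≤ ((ε * ρ y / 2) ^ N)⁻¹ := by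
            gcongr
            nlinarith
          calc _ = K * (ε ^ h)⁻¹ * ((ε * ρ x) ^ N)⁻¹ := by
                rw [mul_pow _ _ h]
                field_simp
            _ ≤ _ := by gcongr
        · rw [ballKernel_of_not_le _ hx]
          exact zero_le
    _ = _ := by
        rw [lintegral_indicator measurableSet_closedBall, setLIntegral_const,
          volume_closedBall_eq _ (by positivity), ← ENNReal.ofReal_mul (by positivity)]
        congr 1
        have : (2 * (ε * ρ y)) ^ N = 4 ^ N * (ε * ρ y / 2) ^ N := by
          rw [← mul_pow]
          ring
        rw [this]
        field_simp

/-- The kernel of the superposition of averages over all balls `closedBall x s` of radius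
`s ≤ ε ρ(x)`. -/
def coneKernel (ρ : Eucl N → ℝ) (ε : ℝ) (c d : ℝ → ℝ) : (Eucl N × ℝ) × Eucl N → ℝ≥0∞ :=
  {p | 0 < p.1.2 ∧ p.1.2 ≤ ε * ρ p.1.1 ∧ dist p.2 p.1.1 ≤ p.1.2}.indicator
    fun p => ENNReal.ofReal (c (ρ p.1.1)) * ENNReal.ofReal (d p.1.2)

theorem coneKernel_of_le {ρ : Eucl N → ℝ} {ε : ℝ} (c d : ℝ → ℝ) {x y : Eucl N} {s : ℝ}
    (h : 0 < s ∧ s ≤ ε * ρ x ∧ dist y x ≤ s) :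
    coneKernel ρ ε c d ((x, s), y) = ENNReal.ofReal (c (ρ x)) * ENNReal.ofReal (d s) :=
  Set.indicator_of_mem (s := {p : (Eucl N × ℝ) × Eucl N |
    0 < p.1.2 ∧ p.1.2 ≤ ε * ρ p.1.1 ∧ dist p.2 p.1.1 ≤ p.1.2}) (a := ((x, s), y)) h _

theorem coneKernel_of_not_le {ρ : Eucl N → ℝ} {ε : ℝ} (c d : ℝ → ℝ) {x y : Eucl N} {s : ℝ}
    (h : ¬(0 < s ∧ s ≤ ε * ρ x ∧ dist y x ≤ s)) : coneKernel ρ ε c d ((x, s), y) = 0 :=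
  Set.indicator_of_notMem (s := {p : (Eucl N × ℝ) × Eucl N |
    0 < p.1.2 ∧ p.1.2 ≤ ε * ρ p.1.1 ∧ dist p.2 p.1.1 ≤ p.1.2}) (a := ((x, s), y)) h _

theorem measurable_coneKernel {ρ : Eucl N → ℝ} (hρ : Continuous ρ) (ε : ℝ) {c d : ℝ → ℝ}
    (hc : Measurable c) (hd : Measurable d) : Measurable (coneKernel ρ ε c d) := by
  have h1 : Measurable ρ := hρ.measurable
  have s1 : MeasurableSet {p : (Eucl N × ℝ) × Eucl N | 0 < p.1.2} :=
    measurableSet_lt (by fun_prop) (by fun_prop)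
  have s2 : MeasurableSet {p : (Eucl N × ℝ) × Eucl N | p.1.2 ≤ ε * ρ p.1.1} :=
    measurableSet_le (by fun_prop) (by fun_prop)
  have s3 : MeasurableSet {p : (Eucl N × ℝ) × Eucl N | dist p.2 p.1.1 ≤ p.1.2} :=
    measurableSet_le (by fun_prop) (by fun_prop)
  exact Measurable.indicator (by fun_prop) (s1.inter (s2.inter s3))

theorem lintegral_lintegral_coneKernel_mul (ρ : Eucl N → ℝ) (ε : ℝ) (c d : ℝ → ℝ) (x : Eucl N)
    (W : Eucl N → ℝ≥0∞) :
    ∫⁻ s, ∫⁻ y, coneKernel ρ ε c d ((x, s), y) * W y =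
      ENNReal.ofReal (c (ρ x)) * ∫⁻ s in Set.Ioc 0 (ε * ρ x), ENNReal.ofReal (d s) *
        ∫⁻ y in closedBall x s, W y := by
  rw [← lintegral_const_mul' _ _ ENNReal.ofReal_ne_top, ← lintegral_indicator measurableSet_Ioc]
  refine lintegral_congr fun s => ?_
  by_cases hs : s ∈ Set.Ioc 0 (ε * ρ x)
  · rw [Set.indicator_of_mem hs, ← mul_assoc, ← lintegral_const_mul' _ _ (by finiteness),
      ← lintegral_indicator measurableSet_closedBall]
    refine lintegral_congr fun y => ?_
    by_cases hy : y ∈ closedBall x s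
    · rw [Set.indicator_of_mem hy, coneKernel_of_le c d ⟨hs.1, hs.2, hy⟩]
    · rw [Set.indicator_of_notMem hy, coneKernel_of_not_le c d fun h => hy h.2.2, zero_mul]
  · rw [Set.indicator_of_notMem hs]
    refine lintegral_eq_zero_of_ae_eq_zero (.of_forall fun y => ?_)
    simp [coneKernel_of_not_le c d (x := x) (y := y) fun h => hs ⟨h.1, h.2.1⟩]

/-- For fixed `y` and `s`, the variable `x` ranges in a ball of radius `s`, whose volume cancels
`s⁻ᴺ` and leaves `s³⁻ʰ`, bounded because `h ≤ 3`. Only `s ≤ T = 2ερ(y)` contributes, so the total is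
`(2ρ(y))ʰ T⁴⁻ʰ = 16 ε⁴⁻ʰ ρ(y)⁴` up to the factor `K` and the unit ball volume. -/
theorem IsSlowScale.lintegral_coneKernel_le {ρ : Eucl N → ℝ} {ε : ℝ} (hρ : IsSlowScale ρ ε)
    {K : ℝ} (hK : 0 ≤ K) {h : ℕ} (hh : h ≤ 3) (y : Eucl N) :
    ∫⁻ z, coneKernel ρ ε (fun t => t ^ h) (fun s => K * (s ^ 3 * (s ^ N)⁻¹ * (s ^ h)⁻¹)) (z, y) ≤
      ENNReal.ofReal (K * (16 * unitBallVolume N) * ε ^ (4 - h)) *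
        ENNReal.ofReal (ρ y ^ 4) := by
  have hε := hρ.eps_pos
  have hy0 := hρ.pos y
  have hω := unitBallVolume_nonneg N
  set T : ℝ := 2 * (ε * ρ y) with hT
  have hT0 : 0 < T := by positivity
  set A : ℝ := (2 * ρ y) ^ h * (K * unitBallVolume N * T ^ (3 - h)) with hA
  have hA0 : 0 ≤ A := by positivity
  have hmeas : Measurable fun z => coneKernel ρ ε (fun t => t ^ h)
      (fun s => K * (s ^ 3 * (s ^ N)⁻¹ * (s ^ h)⁻¹)) (z, y) :=
    (measurable_coneKernel hρ.continuous ε (by fun_prop) (by fun_prop)).comp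
      measurable_prodMk_right
  rw [Measure.volume_eq_prod, lintegral_prod_symm' _ hmeas]
  calc _ ≤ ∫⁻ s, (Set.Ioc 0 T).indicator (fun _ => ENNReal.ofReal A) s := by
        refine lintegral_mono fun s => ?_
        by_cases hs : s ∈ Set.Ioc 0 T
        · rw [Set.indicator_of_mem hs]
          have hs0 := hs.1
          calc _ ≤ ∫⁻ x, (closedBall y s).indicator (fun _ => ENNReal.ofReal
                ((2 * ρ y) ^ h * (K * (s ^ 3 * (s ^ N)⁻¹ * (s ^ h)⁻¹)))) x := by
                refine lintegral_mono fun x => ?_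
                by_cases hx : 0 < s ∧ s ≤ ε * ρ x ∧ dist y x ≤ s
                · have h1 := (hρ.le_two_mul x y (hx.2.2.trans hx.2.1)).1
                  have hx0 := hρ.pos x
                  rw [Set.indicator_of_mem (mem_closedBall'.2 hx.2.2), coneKernel_of_le _ _ hx,
                    ← ENNReal.ofReal_mul (by positivity)]
                  refine ENNReal.ofReal_le_ofReal ?_
                  gcongr
                · rw [coneKernel_of_not_le _ _ hx]
                  exact zero_le
            _ = ENNReal.ofReal ((2 * ρ y) ^ h * (K * (s ^ 3 * (s ^ N)⁻¹ * (s ^ h)⁻¹)) *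
                  (s ^ N * unitBallVolume N)) := by
                rw [lintegral_indicator measurableSet_closedBall, setLIntegral_const,
                  volume_closedBall_eq _ hs0.le, ← ENNReal.ofReal_mul (by positivity)]
            _ ≤ ENNReal.ofReal A := by
                refine ENNReal.ofReal_le_ofReal ?_
                have e : s ^ 3 = s ^ (3 - h) * s ^ h := by rw [← pow_add, Nat.sub_add_cancel hh]
                calc _ = (2 * ρ y) ^ h * (K * unitBallVolume N * s ^ (3 - h)) := by
                      rw [e]
                      field_simp
                  _ ≤ _ := by
                      rw [hA]
                      have := hs.2
                      gcongr
        · rw [Set.indicator_of_notMem hs, nonpos_iff_eq_zero]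
          refine lintegral_eq_zero_of_ae_eq_zero (.of_forall fun x => ?_)
          refine coneKernel_of_not_le _ _ ?_
          rintro ⟨h1, h2, h3⟩
          refine hs ⟨h1, h2.trans ?_⟩
          have := (hρ.le_two_mul x y (h3.trans h2)).1
          rw [hT]
          nlinarith
    _ = _ := by
        rw [lintegral_indicator measurableSet_Ioc, setLIntegral_const, Real.volume_Ioc, sub_zero,
          ← ENNReal.ofReal_mul hA0, ← ENNReal.ofReal_mul (by positivity)]
        congr 1
        rw [hA, hT]
        interval_cases h <;> norm_num <;> ring

/-- The weighted estimate for a weak derivative, at a slowly varying scale. -/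
theorem exists_lintegral_weakDeriv_le (N : ℕ) {h : ℕ} (hh : h ≤ 3) :
    ∃ K : ℝ, 0 ≤ K ∧ ∀ (ρ : Eucl N → ℝ) (ε : ℝ), IsSlowScale ρ ε →
      ∀ (I : Fin h → Fin N) (u v w : Eucl N → ℂ), AEStronglyMeasurable u volume →
        HasWeakDeriv I u v → HasWeakBilaplacian u w →
          ∫⁻ x, ENNReal.ofReal (ρ x ^ h) * ‖v x‖ₑ ≤
            ENNReal.ofReal (K * ε ^ (4 - h)) * (∫⁻ x, ENNReal.ofReal (ρ x ^ 4) * ‖w x‖ₑ) +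
              ENNReal.ofReal (K * (ε ^ h)⁻¹) * ∫⁻ x, ‖u x‖ₑ := by
  obtain ⟨K, hK, hmain⟩ := exists_enorm_weakDeriv_le N h
  have hω := unitBallVolume_nonneg N
  refine ⟨K * (4 ^ N * unitBallVolume N) + K * (16 * unitBallVolume N), by positivity,
    fun ρ ε hρ I u v w hu hv hw => ?_⟩
  have hε := hρ.eps_pos
  set c : ℝ → ℝ := fun t => t ^ h * (K * (((ε * t) ^ N)⁻¹ * ((ε * t) ^ h)⁻¹)) with hc
  set d : ℝ → ℝ := fun s => K * (s ^ 3 * (s ^ N)⁻¹ * (s ^ h)⁻¹) with hd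
  have hk₁ := measurable_ballKernel hρ.continuous ε (c := c) (by fun_prop)
  have hk₂ := measurable_coneKernel hρ.continuous ε (c := fun t => t ^ h) (d := d)
    (by fun_prop) (by fun_prop)
  have huM : AEMeasurable (fun y => ‖u y‖ₑ) volume := hu.enorm
  have hwM : AEMeasurable (fun y => ‖w y‖ₑ) volume := hw.1.aestronglyMeasurable.enorm
  have hF₁ : AEMeasurable (fun x => ∫⁻ y, ballKernel ρ ε c (x, y) * ‖u y‖ₑ) volume :=
    (hk₁.aemeasurable.mul huM.comp_snd).lintegral_prod_right'
  have hF₂ : AEMeasurable (fun z : Eucl N × ℝ =>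
      ∫⁻ y, coneKernel ρ ε (fun t => t ^ h) d (z, y) * ‖w y‖ₑ) (volume.prod volume) :=
    (hk₂.aemeasurable.mul hwM.comp_snd).lintegral_prod_right'
  have h1 : ∫⁻ x, ∫⁻ y, ballKernel ρ ε c (x, y) * ‖u y‖ₑ ≤
      ENNReal.ofReal (K * (4 ^ N * unitBallVolume N) * (ε ^ h)⁻¹) * ∫⁻ x, ‖u x‖ₑ := by
    rw [← lintegral_const_mul' _ _ ENNReal.ofReal_ne_top]
    exact lintegral_lintegral_mul_le hk₁ huM fun y => hρ.lintegral_ballKernel_le hK h y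
  have h2 : ∫⁻ x, ∫⁻ s, ∫⁻ y, coneKernel ρ ε (fun t => t ^ h) d ((x, s), y) * ‖w y‖ₑ ≤
      ENNReal.ofReal (K * (16 * unitBallVolume N) * ε ^ (4 - h)) *
        ∫⁻ x, ENNReal.ofReal (ρ x ^ 4) * ‖w x‖ₑ := by
    rw [← lintegral_prod _ hF₂, ← lintegral_const_mul' _ _ ENNReal.ofReal_ne_top]
    simp only [← mul_assoc (ENNReal.ofReal _)]
    exact lintegral_lintegral_mul_le hk₂ hwM fun y => hρ.lintegral_coneKernel_le hK hh y
  calc _ ≤ ∫⁻ x, ((∫⁻ y, ballKernel ρ ε c (x, y) * ‖u y‖ₑ) +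
        ∫⁻ s, ∫⁻ y, coneKernel ρ ε (fun t => t ^ h) d ((x, s), y) * ‖w y‖ₑ) := by
        refine lintegral_mono_ae ?_
        filter_upwards [hmain I u v w hv hw] with x hx
        have hx0 := hρ.pos x
        rw [lintegral_ballKernel_mul, lintegral_lintegral_coneKernel_mul, hc,
          ENNReal.ofReal_mul (by positivity), mul_assoc, ← mul_add]
        gcongr
        exact hx _ (by positivity)
    _ = _ := lintegral_add_left' hF₁ _
    _ ≤ _ := by
        rw [add_comm]
        refine add_le_add (h2.trans ?_) (h1.trans ?_)
        · gcongr
          exact le_add_of_nonneg_left (by positivity)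
        · gcongr
          exact le_add_of_nonneg_right (by positivity)

end VariableScale

/-! ### The scale `√a` and the weighted inequality -/

section Weighted

variable {N : ℕ} {κ ν : ℝ} {a : Eucl N → ℝ}

theorem CoeffAssumption.pos (ha : CoeffAssumption N κ ν a) (x : Eucl N) : 0 < a x :=
  ha.nu_pos.trans_le (ha.lower_bound x)

theorem norm_le_of_forall_single {L : Eucl N →L[ℝ] ℝ} {M : ℝ}
    (hL : ∀ i, |L (EuclideanSpace.single i 1)| ≤ M) : ‖L‖ ≤ N * M := by
  have hM : 0 ≤ N * M := by
    rcases N with _ | n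
    · simp
    · have := (abs_nonneg _).trans (hL 0)
      positivity
  refine L.opNorm_le_bound hM fun v => ?_
  have e : L v = ∑ i, v i * L (EuclideanSpace.single i 1) := by
    conv_lhs => rw [← (EuclideanSpace.basisFun (Fin N) ℝ).sum_repr v]
    simp
  rw [e]
  calc _ ≤ ∑ i : Fin N, M * ‖v‖ := by
        refine norm_sum_le_of_le _ fun i _ => ?_
        rw [norm_mul, mul_comm]
        exact mul_le_mul (hL i) (PiLp.norm_apply_le v i) (norm_nonneg _)
          ((abs_nonneg _).trans (hL i))
    _ = _ := by simp [mul_assoc]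

/-- The gradient of `√a` is `Da / (2√a)`, and the first order bound on `a` cancels the denominator;
the mean value inequality concludes. -/
theorem CoeffAssumption.abs_sqrt_sub_sqrt_le (ha : CoeffAssumption N κ ν a) (x y : Eucl N) :
    |√(a x) - √(a y)| ≤ N * κ * dist x y := by
  have hd : ∀ z, HasFDerivAt (fun z => √(a z)) ((1 / (2 * √(a z))) • fderiv ℝ a z) z := fun z =>
    ((ha.contDiff.differentiable (by simp) z).hasFDerivAt).sqrt (ha.pos z).ne'
  have hb : ∀ z ∈ Set.univ, ‖(1 / (2 * √(a z))) • fderiv ℝ a z‖ ≤ N * κ := by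
    intro z _
    have hs : 0 < √(a z) := Real.sqrt_pos.2 (ha.pos z)
    have h1 : ‖fderiv ℝ a z‖ ≤ N * (κ * √(a z)) := by
      refine norm_le_of_forall_single fun i => ?_
      have := ha.bound_one (fun _ => i) z
      rwa [partialDeriv, iteratedFDeriv_one_apply, ← Real.sqrt_eq_rpow] at this
    have hκ := ha.kappa_pos
    calc _ ≤ 1 / (2 * √(a z)) * (N * (κ * √(a z))) := by
          rw [norm_smul, Real.norm_of_nonneg (by positivity)]
          gcongr
      _ = N * κ / 2 := by field_simp
      _ ≤ N * κ := half_le_self (by positivity)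
  have := convex_univ.norm_image_sub_le_of_norm_hasFDerivWithin_le
    (fun z _ => (hd z).hasFDerivWithinAt) hb (Set.mem_univ y) (Set.mem_univ x)
  rwa [← dist_eq_norm x y] at this

theorem CoeffAssumption.isSlowScale (ha : CoeffAssumption N κ ν a) {ε : ℝ} (hε : 0 < ε)
    (hεκ : ε * (N * κ) ≤ 1 / 2) : IsSlowScale (fun x => √(a x)) ε := by
  refine ⟨fun x => Real.sqrt_pos.2 (ha.pos x), ha.contDiff.continuous.sqrt, hε, fun x y hxy => ?_⟩
  have hκ := ha.kappa_pos
  have h1 : |√(a y) - √(a x)| ≤ √(a x) / 2 := by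
    calc _ ≤ N * κ * dist y x := ha.abs_sqrt_sub_sqrt_le y x
      _ ≤ N * κ * (ε * √(a x)) := by gcongr
      _ = ε * (N * κ) * √(a x) := by ring
      _ ≤ 1 / 2 * √(a x) := by gcongr
      _ = _ := by ring
  have h2 := abs_le.1 h1
  have h3 := Real.sqrt_nonneg (a x)
  constructor <;> linarith [h2.1, h2.2]

theorem rpow_half_eq_sqrt_pow {t : ℝ} (ht : 0 ≤ t) (h : ℕ) : t ^ ((h : ℝ) / 2) = √t ^ h := by
  rw [Real.sqrt_eq_rpow, ← Real.rpow_natCast, ← Real.rpow_mul ht]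
  ring_nf

theorem weightedNorm_le_sum {h : ℕ} (ha : CoeffAssumption N κ ν a)
    {V : (Fin h → Fin N) → Eucl N → ℂ} (hV : ∀ I, AEStronglyMeasurable (V I) volume) :
    weightedNorm a V ≤ ∑ I, ∫⁻ x, ENNReal.ofReal (√(a x) ^ h) * ‖V I x‖ₑ := by
  have hc : Continuous fun x => √(a x) ^ h := ha.contDiff.continuous.sqrt.pow h
  have hm : ∀ I ∈ Finset.univ, AEMeasurable
      (fun x => ENNReal.ofReal (√(a x) ^ h) * ‖V I x‖ₑ) volume := fun I _ =>
    hc.measurable.ennreal_ofReal.aemeasurable.mul (hV I).enorm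
  rw [weightedNorm, normL1, eLpNorm_one_eq_lintegral_enorm, ← lintegral_finsetSum' _ hm]
  refine lintegral_mono fun x => ?_
  have h1 : √(∑ I, ‖V I x‖ ^ 2) ≤ ∑ I, ‖V I x‖ :=
    Real.sqrt_le_iff.2 ⟨by positivity, Finset.sum_sq_le_sq_sum_of_nonneg fun I _ => norm_nonneg _⟩
  rw [rpow_half_eq_sqrt_pow (ha.pos x).le, Real.enorm_of_nonneg (by positivity), ← Finset.mul_sum,
    ENNReal.ofReal_mul (by positivity)]
  gcongr
  refine (ENNReal.ofReal_le_ofReal h1).trans_eq ?_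
  rw [ENNReal.ofReal_sum_of_nonneg fun I _ => norm_nonneg _]
  simp

theorem normL1_neg_sq_smul (ha : CoeffAssumption N κ ν a) (w : Eucl N → ℂ) :
    normL1 (fun x => -((a x) ^ 2 • w x)) = ∫⁻ x, ENNReal.ofReal (√(a x) ^ 4) * ‖w x‖ₑ := by
  rw [normL1, eLpNorm_one_eq_lintegral_enorm]
  refine lintegral_congr fun x => ?_
  have h1 : √(a x) ^ 4 = (a x) ^ 2 := by
    rw [show 4 = 2 * 2 from rfl, pow_mul, Real.sq_sqrt (ha.pos x).le]
  rw [enorm_neg, enorm_smul, h1, Real.enorm_of_nonneg (by positivity)]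

/-- Stated for every `K ≥ K₀` so that one `K` can serve all orders `h`. -/
theorem exists_weightedNorm_le_of_order (N : ℕ) {h : ℕ} (hh : h ≤ 3) :
    ∃ K₀ : ℝ, ∀ K, K₀ ≤ K → ∀ (κ ν : ℝ) (a : Eucl N → ℝ), CoeffAssumption N κ ν a →
      ∀ ε : ℝ, 0 < ε → ε * (N * κ) ≤ 1 / 2 →
        ∀ (u w : Eucl N → ℂ) (V : (Fin h → Fin N) → Eucl N → ℂ),
          AEStronglyMeasurable u volume → (∀ I, HasWeakDeriv I u (V I)) →
            HasWeakBilaplacian u w →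
              weightedNorm a V ≤
                ENNReal.ofReal (K * ε ^ (4 - h)) * normL1 (fun x => -((a x) ^ 2 • w x)) +
                  ENNReal.ofReal (K * (ε ^ h)⁻¹) * normL1 u := by
  obtain ⟨K₁, hK₁, hmain⟩ := exists_lintegral_weakDeriv_le N hh
  refine ⟨N ^ h * K₁, fun K hK κ ν a ha ε hε hεκ u w V hu hV hw => ?_⟩
  refine (weightedNorm_le_sum ha fun I => (hV I).1.aestronglyMeasurable).trans ?_
  refine (Finset.sum_le_sum fun I _ =>
    hmain _ ε (ha.isSlowScale hε hεκ) I u (V I) w hu (hV I) hw).trans ?_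
  rw [normL1_neg_sq_smul ha, normL1, eLpNorm_one_eq_lintegral_enorm, Finset.sum_const,
    Finset.card_univ, Fintype.card_fun, Fintype.card_fin, Fintype.card_fin, nsmul_eq_mul, mul_add,
    ← mul_assoc, ← mul_assoc]
  have hN : ((N ^ h : ℕ) : ℝ≥0∞) = ENNReal.ofReal ((N : ℝ) ^ h) := by
    rw [← Nat.cast_pow, ENNReal.ofReal_natCast]
  rw [hN, ← ENNReal.ofReal_mul (by positivity), ← ENNReal.ofReal_mul (by positivity), ← mul_assoc,
    ← mul_assoc]
  gcongr

/-- The weighted interpolation inequality, for weak derivatives of orders one, two, three. -/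
theorem exists_weightedNorm_le (hN : 1 ≤ N) (hκ : 0 < κ) :
    ∃ C : ℝ, 0 < C ∧ ∃ ε₀ : ℝ, 0 < ε₀ ∧ ∀ (ν : ℝ) (a : Eucl N → ℝ), CoeffAssumption N κ ν a →
      ∀ ε : ℝ, 0 < ε → ε < ε₀ → ∀ h : ℕ, h ≤ 3 →
        ∀ (u w : Eucl N → ℂ) (V : (Fin h → Fin N) → Eucl N → ℂ),
          AEStronglyMeasurable u volume → (∀ I, HasWeakDeriv I u (V I)) →
            HasWeakBilaplacian u w →
              weightedNorm a V ≤
                ENNReal.ofReal (ε ^ (4 - h)) * normL1 (fun x => -((a x) ^ 2 • w x)) +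
                  ENNReal.ofReal (C / ε ^ h) * normL1 u := by
  choose! K₀ hK₀ using fun (h : ℕ) (hh : h ≤ 3) => exists_weightedNorm_le_of_order N hh
  set K : ℝ := 1 + ∑ h ∈ Finset.range 4, |K₀ h| with hKdef
  have hK1 : 1 ≤ K := le_add_of_nonneg_right (Finset.sum_nonneg fun _ _ => abs_nonneg _)
  have hNpos : (0 : ℝ) < N := by exact_mod_cast hN
  -- The previous estimate is used at `ε / K`. As `K ≥ 1` and `h ≤ 3`, `K (ε/K)⁴⁻ʰ ≤ ε⁴⁻ʰ` removes
  -- the constant before `‖Au‖₁`, while `K (ε/K)⁻ʰ = Kʰ⁺¹/εʰ ≤ K⁴/εʰ`.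
  refine ⟨K ^ 4, by positivity, 1 / (2 * (N * κ)), by positivity,
    fun ν a ha ε hε hεlt h hh u w V hu hV hw => ?_⟩
  have hKh : K₀ h ≤ K := by
    have := Finset.single_le_sum (fun i _ => abs_nonneg (K₀ i))
      (Finset.mem_range.2 (Nat.lt_succ_of_le hh))
    linarith [le_abs_self (K₀ h)]
  have hεK : ε / K ≤ ε := div_le_self hε.le hK1
  have hεκ : ε / K * (N * κ) ≤ 1 / 2 := by
    have h1 : ε * (2 * (N * κ)) < 1 := (lt_div_iff₀ (by positivity)).1 hεlt
    have h2 : ε / K * (N * κ) ≤ ε * (N * κ) := by gcongr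
    linarith
  refine (hK₀ h hh K hKh κ ν a ha (ε / K) (by positivity) hεκ u w V hu hV hw).trans ?_
  gcongr
  · rw [div_pow, mul_div_assoc', div_le_iff₀ (by positivity), mul_comm]
    gcongr
    exact le_self_pow₀ hK1 (by omega)
  · rw [div_pow, inv_div, mul_div_assoc', ← pow_succ']
    gcongr
    omega

end Weighted

end FourthOrderL1

end

/-! ### The two estimates for the operator -/

theorem mainTheorem5 (N : ℕ) (hN : 1 ≤ N) (κ : ℝ) (hκ : 0 < κ) :
    (∃ C : ℝ, 0 < C ∧ ∃ ε₀ : ℝ, 0 < ε₀ ∧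
      ∀ (ν : ℝ) (a : Eucl N → ℝ), CoeffAssumption N κ ν a →
        ∀ ε : ℝ, 0 < ε → ε < ε₀ →
          ∀ u : Eucl N → ℂ, IsTestFunction u →
            ∀ h : ℕ, 1 ≤ h → h ≤ 3 →
              weightedNorm a (fun I : Fin h → Fin N => partialDeriv I u) ≤
                ENNReal.ofReal (ε ^ (4 - h)) * normL1 (opAClassical a u) +
                  ENNReal.ofReal (C / ε ^ h) * normL1 u) ∧
    (∃ C : ℝ, 0 < C ∧
      ∀ (ν : ℝ) (a : Eucl N → ℝ), CoeffAssumption N κ ν a →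
        ∀ u ∈ domA1 a,
          weightedNorm a (fun I : Fin 1 → Fin N => weakDeriv I u) +
              weightedNorm a (fun I : Fin 2 → Fin N => weakDeriv I u) +
              weightedNorm a (fun I : Fin 3 → Fin N => weakDeriv I u) ≤
            ENNReal.ofReal C * (normL1 (opA a u) + normL1 u)) := by
  obtain ⟨C, hC, ε₀, hε₀, hmain⟩ := exists_weightedNorm_le (κ := κ) hN hκ
  refine ⟨⟨C, hC, ε₀, hε₀, fun ν a ha ε hε hεlt u hu h _ hh => ?_⟩, ?_⟩
  · exact hmain ν a ha ε hε hεlt h hh u _ _ hu.1.continuous.aestronglyMeasurable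
      (fun I => hasWeakDeriv_partialDeriv I hu.1) (hasWeakBilaplacian_laplacian hu.1)
  -- Part (ii) is the weak inequality at the fixed value `ε = ε₀/2`, with the coefficients of the
  -- three orders added up.
  · set e : ℝ := ε₀ / 2 with he
    have he0 : 0 < e := half_pos hε₀
    refine ⟨∑ h ∈ Finset.Icc 1 3, (e ^ (4 - h) + C / e ^ h),
      Finset.sum_pos (fun h _ => by positivity) ⟨1, by simp⟩, fun ν a ha u hu => ?_⟩
    have key : ∀ h : ℕ, 1 ≤ h → h ≤ 3 →
        weightedNorm a (fun I : Fin h → Fin N => weakDeriv I u) ≤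
          ENNReal.ofReal (e ^ (4 - h) + C / e ^ h) * (normL1 (opA a u) + normL1 u) := by
      intro h h1 h3
      refine (hmain ν a ha e he0 (half_lt_self hε₀) h h3 u _ _ hu.1.1
        (fun I => weakDeriv_spec (hu.2.1 h h1 h3 I).1) (weakBilaplacian_spec hu.2.2.1)).trans ?_
      rw [mul_add]
      refine add_le_add ?_ ?_
      · refine mul_le_mul' (ENNReal.ofReal_le_ofReal ?_) le_rfl
        exact le_add_of_nonneg_right (by positivity)
      · refine mul_le_mul' (ENNReal.ofReal_le_ofReal ?_) le_rfl
        exact le_add_of_nonneg_left (by positivity)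
    rw [ENNReal.ofReal_sum_of_nonneg fun h _ => by positivity, Finset.sum_mul,
      show Finset.Icc 1 3 = {1, 2, 3} from rfl]
    rw [Finset.sum_insert (by simp), Finset.sum_insert (by simp), Finset.sum_singleton, ← add_assoc]
    exact add_le_add (add_le_add (key 1 le_rfl (by norm_num)) (key 2 (by norm_num) (by norm_num)))
      (key 3 (by norm_num) le_rfl)
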